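/- Let $m\ge 1$ and let $\sigma_0=\pm1$ if $m$ is odd, $\sigma_0=(-1)^{m/2}$ if $m$ is even. Consider the Cauchy problem $$\partial_t u+\sigma_0\,\partial_x^m u=0,\qquad u(x,0)=u_0(x)\qquad (x\in\mathbb R,\ t\ge 0),$$ with initial data $u_0(x)=\sum_{j=1}^n \hat v_j e^{ik_jx}$ for some $n<\infty$, $\hat v_j\in\mathbb C$ and $k_j\in\mathbb R$. For $\tau>0$ consider the first-order system for $q=(q_0,\dots,q_{m-1})$ $$\partial_t q_0+\sigma_0\,\partial_x q_{m-1}=0,\qquad \tau\,\partial_t q_j=s_j\,(q_{m-j}-\partial_x q_{m-j-1})\quad (1\le j\le m-1),$$ $$s_j=\sigma_0(-1)^j\ \text{ if } j<m/2,\qquad s_j=\sigma_0(-1)^{m-j-1}\ \text{ if } j\ge m/2,$$ with initial data $q_j(x,0)=\partial_x^j u_0(x)$ for $0\le j\le m-1$. By a solution of either problem we mean a classical solution on $\mathbb R\times[0,\infty)$ that is, together with its $x$-derivatives up to the order of the equation (order $m$ for $u$, order $1$ for $q$), bounded on $\mathbb R\times[0,T']$ for every $T'<\infty$. Then both problems have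 solutions, the second one for every $\tau>0$. If $u$ is a solution of the first problem, $q=q^{(\tau)}$ are solutions of the second one, and $0\le T<\infty$, then $$\|q_0^{(\tau)}(\cdot,T)-u(\cdot,T)\|_\infty=\mathcal O(\tau)\qquad\text{as }\tau\to0^+,$$ that is, there are $C$ and $\tau_0>0$, which do not depend on $x$ or $\tau$, such that $|q_0^{(\tau)}(x,T)-u(x,T)|\le C\tau$ for all $x\in\mathbb R$ and $0<\tau<\tau_0$. -/

import Mathlib

open Filter Topology

namespace Hyperbolization

/-- The sign condition on `σ₀` in `∂ₜ u + σ₀ ∂ₓᵐ u = 0`: `σ₀ = ± 1` for odd `m`, and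
`σ₀ = (-1) ^ (m / 2)` for even `m`. -/
def AdmissibleSign (m : ℕ) (σ₀ : ℝ) : Prop :=
  (Odd m → σ₀ = 1 ∨ σ₀ = -1) ∧ (Even m → σ₀ = (-1) ^ (m / 2))

/-- The space of functions `v(x) = ∑ⱼ v̂ⱼ exp(i kⱼ x)` with `n` modes of arbitrary real
wavenumbers `kⱼ`. -/
def FourierSpace (n : ℕ) : Set (ℝ → ℂ) :=
  {v | ∃ (c : Fin n → ℂ) (k : Fin n → ℝ),
    ∀ x : ℝ, v x = ∑ j, c j * Complex.exp (Complex.I * (k j : ℂ) * (x : ℂ))}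

/-- `u x t` is a bounded classical solution on `ℝ × [0, ∞)` of
`∂ₜ u + σ₀ ∂ₓᵐ u = 0`, `u(x, 0) = u₀(x)`.
Bounded: `u` and its `x`-derivatives up to order `m` are bounded on every strip `ℝ × [0, T]`. -/
structure IsModelSolution (m : ℕ) (σ₀ : ℝ) (u₀ : ℝ → ℂ) (u : ℝ → ℝ → ℂ) : Prop where
  contDiff : ∀ t : ℝ, 0 ≤ t → ContDiff ℝ m (fun x => u x t)
  bounded : ∀ T : ℝ, ∃ M : ℝ, ∀ t : ℝ, 0 ≤ t → t ≤ T → ∀ j ≤ m, ∀ x : ℝ,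
    ‖iteratedDeriv j (fun y => u y t) x‖ ≤ M
  equation : ∀ x t : ℝ, 0 ≤ t →
    HasDerivWithinAt (fun s => u x s)
      (-((σ₀ : ℂ) * iteratedDeriv m (fun y => u y t) x)) (Set.Ici 0) t
  initial : ∀ x : ℝ, u x 0 = u₀ x

/-- The sign of the constraint `q_{m-j} - ∂ₓ q_{m-j-1}` in the equation for `q_j`, that is the
entry in row `j` and column `m - j` of the antidiagonal signed permutation matrix `P` of the
stable hyperbolization (`1 ≤ j ≤ m - 1`). -/
def stableSign (m : ℕ) (σ₀ : ℝ) (j : ℕ) : ℝ :=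
  if 2 * j < m then σ₀ * (-1) ^ j else σ₀ * (-1) ^ (m - j - 1)

/-- `q j x t` (`0 ≤ j ≤ m - 1`; the other indices play no role) is a bounded classical solution on
`ℝ × [0, ∞)` of the stable hyperbolization
`∂ₜ q₀ + σ₀ ∂ₓ q_{m-1} = 0`, `τ ∂ₜ q_j = s_j (q_{m-j} - ∂ₓ q_{m-j-1})` for `1 ≤ j ≤ m - 1`,
with initial data `q_j(x, 0) = ∂ₓʲ u₀(x)`.
Bounded: all `q_j` and `∂ₓ q_j` are bounded on every strip `ℝ × [0, T]`. -/
structure IsHyperbolizationSolution (m : ℕ) (σ₀ τ : ℝ) (u₀ : ℝ → ℂ)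
    (q : ℕ → ℝ → ℝ → ℂ) : Prop where
  contDiff : ∀ j < m, ∀ t : ℝ, 0 ≤ t → ContDiff ℝ 1 (fun x => q j x t)
  bounded : ∀ T : ℝ, ∃ M : ℝ, ∀ t : ℝ, 0 ≤ t → t ≤ T → ∀ j < m, ∀ x : ℝ,
    ‖q j x t‖ ≤ M ∧ ‖deriv (fun y => q j y t) x‖ ≤ M
  equation_zero : ∀ x t : ℝ, 0 ≤ t →
    HasDerivWithinAt (fun s => q 0 x s)
      (-((σ₀ : ℂ) * deriv (fun y => q (m - 1) y t) x)) (Set.Ici 0) t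
  equation_succ : ∀ j : ℕ, 1 ≤ j → j < m → ∀ x t : ℝ, 0 ≤ t →
    HasDerivWithinAt (fun s => q j x s)
      (((stableSign m σ₀ j / τ : ℝ) : ℂ) *
        (q (m - j) x t - deriv (fun y => q (m - j - 1) y t) x)) (Set.Ici 0) t
  initial : ∀ j < m, ∀ x : ℝ, q j x 0 = iteratedDeriv j u₀ x

end Hyperbolization

namespace Hyperbolization
open MeasureTheory FourierTransform
open scoped Real ComplexConjugate

/-! Both problems are solved by trigonometric sums with time-dependent amplitudes, and bounded
classical solutions are unique, so the claim reduces to a single mode: an ODE system with `κ = i k`,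
where the limit amplitude is `U = v exp(λ t)`, `λ = -σ₀ κ ^ m`.

For one mode, the energy `|e₀|² + τ ∑ⱼ |eⱼ|²` cancels the stiff factor `1 / τ`. The signs `s_j` make
the derivative coupling `j ↔ m - 1 - j` skew-Hermitian and the relaxation coupling `j ↔ m - j` skew
except at `2 j = m`, where it damps. Hence the growth rate does not depend on `τ`
(`AdmissibleSign.energy_estimate`). Comparing with `κ ^ j U` directly leaves a residual of size 1
and only gives `O(√τ)`. `AdmissibleSign.mode_error` therefore compares with `a_j = (κ ^ j (1 + τ c
t) + τ b_j) U`, which solves the equation for `q₀` exactly and the others up to `τ r_j`. The energy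
of the error is then `O(τ³)`, and the correction of `a₀` itself is `O(τ)`.

Uniqueness (`eq_zero_of_hasDerivWithinAt`) holds for any linear constant-coefficient system. Moments
against the derivatives of a band-limited kernel form a closed infinite linear system; as the `L¹`
norms of these derivatives grow only geometrically, iterating it in time gives bounds of the form
`(D t) ^ p / p!`, so the moments vanish. Dilates of the kernel approximate a multiple of a Dirac
mass and recover point values. -/

/-! ### Band-limited kernels and their dilates -/

/-- A continuous function supported in `[-1, 1]` and bounded by `A` is integrable, and its `L¹`
norm is at most `2 A`. -/
theorem integral_norm_le_of_support_Icc {f : ℝ → ℂ} (hf : Continuous f) {A : ℝ}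
    (hA : ∀ x, ‖f x‖ ≤ A) (h0 : ∀ x, 1 < |x| → f x = 0) :
    Integrable f ∧ ∫ x, ‖f x‖ ≤ 2 * A := by
  have hs : Function.support f ⊆ Set.Icc (-1 : ℝ) 1 := by
    intro x hx
    by_contra h
    refine hx (h0 x ?_)
    by_contra h'
    exact h (abs_le.1 (not_lt.1 h'))
  have hc : HasCompactSupport f := HasCompactSupport.of_support_subset_isCompact isCompact_Icc hs
  have hi := hf.integrable_of_hasCompactSupport (μ := volume) hc
  refine ⟨hi, ?_⟩
  have hs' : Function.support (fun x => ‖f x‖) ⊆ Set.Icc (-1 : ℝ) 1 := by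
    intro x hx
    exact hs (by simpa using hx)
  rw [← setIntegral_eq_integral_of_forall_compl_eq_zero (s := Set.Icc (-1 : ℝ) 1)]
  · calc ∫ x in Set.Icc (-1 : ℝ) 1, ‖f x‖ ≤ ∫ x in Set.Icc (-1 : ℝ) 1, A := by
          apply setIntegral_mono hi.norm.integrableOn _ (fun x => hA x)
          simp
      _ = 2 * A := by simp; norm_num
  · intro x hx
    by_contra h
    exact hx (hs' h)

/-- Decay of the Fourier transform from two integrable derivatives. -/
theorem norm_fourier_le_of_hasDerivAt {g g₁ g₂ : ℝ → ℂ} (hg : Integrable g) (hg₁ : Integrable g₁)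
    (hg₂ : Integrable g₂) (h₁ : ∀ x, HasDerivAt g (g₁ x) x) (h₂ : ∀ x, HasDerivAt g₁ (g₂ x) x)
    (x : ℝ) : ‖𝓕 g x‖ ≤ ((∫ y, ‖g y‖) + ∫ y, ‖g₂ y‖) * (1 + x ^ 2)⁻¹ := by
  have e₁ : deriv g = g₁ := funext fun x => (h₁ x).deriv
  have e₂ : deriv g₁ = g₂ := funext fun x => (h₂ x).deriv
  have f₁ := congrFun (Real.fourier_deriv hg (fun x => (h₁ x).differentiableAt) (e₁ ▸ hg₁)) x
  have f₂ := congrFun (Real.fourier_deriv hg₁ (fun x => (h₂ x).differentiableAt) (e₂ ▸ hg₂)) x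
  rw [e₁] at f₁
  rw [e₂, f₁] at f₂
  have b₀ : ‖𝓕 g x‖ ≤ ∫ y, ‖g y‖ :=
    VectorFourier.norm_fourierIntegral_le_integral_norm 𝐞 volume (innerₗ ℝ) g x
  have b₂ : ‖𝓕 g₂ x‖ ≤ ∫ y, ‖g₂ y‖ :=
    VectorFourier.norm_fourierIntegral_le_integral_norm 𝐞 volume (innerₗ ℝ) g₂ x
  rw [f₂] at b₂
  have hn : ‖(2 * (Real.pi : ℂ) * Complex.I * x) • (2 * (Real.pi : ℂ) * Complex.I * x) • 𝓕 g x‖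
      = (2 * Real.pi * |x|) ^ 2 * ‖𝓕 g x‖ := by
    simp [abs_of_pos Real.pi_pos]; ring
  rw [hn, mul_pow, sq_abs] at b₂
  have hpi : (1 : ℝ) ≤ (2 * Real.pi) ^ 2 := by nlinarith [Real.pi_gt_three]
  have hp : 0 < 1 + x ^ 2 := by positivity
  rw [← div_eq_mul_inv, le_div_iff₀ hp]
  nlinarith [mul_le_mul_of_nonneg_right hpi (by positivity : 0 ≤ x ^ 2 * ‖𝓕 g x‖)]

/-- A band-limited kernel `K 0` with its derivatives `K n`: their `L¹` norms grow at most
geometrically and `K 0` does not have mean zero. -/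
theorem exists_bandlimited_kernel : ∃ (K : ℕ → ℝ → ℂ) (C B : ℝ), 0 ≤ C ∧ 1 ≤ B ∧
    (∀ n x, HasDerivAt (K n) (K (n + 1) x) x) ∧ (∀ n, Integrable (K n)) ∧
    (∀ n, ∫ x, ‖K n x‖ ≤ C * B ^ n) ∧ ∫ x, K 0 x ≠ 0 := by
  let b : ContDiffBump (0 : ℝ) := ⟨1 / 2, 1, by norm_num, by norm_num⟩
  let X : ℝ → ℂ := fun x => (b x : ℂ)
  have hX : ContDiff ℝ 2 X := Complex.ofRealCLM.contDiff.comp b.contDiff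
  have hX0 : ∀ x, 1 < |x| → X x = 0 := by
    intro x hx
    have : b x = 0 := b.zero_of_le_dist (by simpa [Real.dist_eq] using hx.le)
    simp [X, this]
  have hderiv0 : ∀ f : ℝ → ℂ, (∀ x, 1 < |x| → f x = 0) → ∀ x, 1 < |x| → deriv f x = 0 := by
    intro f hf x hx
    have : f =ᶠ[𝓝 x] fun _ => 0 := by
      filter_upwards [(isOpen_lt continuous_const continuous_abs).mem_nhds hx] with y hy
      exact hf y hy
    rw [this.deriv_eq]; simp
  have hbdd : ∀ f : ℝ → ℂ, Continuous f → (∀ x, 1 < |x| → f x = 0) → ∃ A, ∀ x, ‖f x‖ ≤ A := by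
    intro f hf h0
    have hs : Function.support f ⊆ Set.Icc (-1 : ℝ) 1 := by
      intro x hx
      by_contra h
      refine hx (h0 x ?_)
      by_contra h'
      exact h (abs_le.1 (not_lt.1 h'))
    exact hf.bounded_above_of_compact_support
      (HasCompactSupport.of_support_subset_isCompact isCompact_Icc hs)
  have hX1 : ContDiff ℝ 1 (deriv X) := ((contDiff_succ_iff_deriv (n := 1)).1 hX).2.2
  have hX2 : ContDiff ℝ 0 (deriv (deriv X)) := ((contDiff_succ_iff_deriv (n := 0)).1 hX1).2.2
  have d0 : ∀ x, HasDerivAt X (deriv X x) x := fun x =>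
    (hX.differentiable (by norm_num) x).hasDerivAt
  have d1 : ∀ x, HasDerivAt (deriv X) (deriv (deriv X) x) x := fun x =>
    (hX1.differentiable (by norm_num) x).hasDerivAt
  have z1 := hderiv0 X hX0
  have z2 := hderiv0 _ z1
  obtain ⟨M0, hM0⟩ := hbdd X hX.continuous hX0
  obtain ⟨M1, hM1⟩ := hbdd _ hX1.continuous z1
  obtain ⟨M2, hM2⟩ := hbdd _ hX2.continuous z2
  have n0 : 0 ≤ M0 := (norm_nonneg _).trans (hM0 0)
  have n1 : 0 ≤ M1 := (norm_nonneg _).trans (hM1 0)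
  have n2 : 0 ≤ M2 := (norm_nonneg _).trans (hM2 0)
  -- Multiplication by `a * x` becomes differentiation after the Fourier transform, so `𝓕 (g n)`
  -- below is the `n`-th derivative of `𝓕 X`.
  let a : ℂ := -2 * Real.pi * Complex.I
  let A : ℝ := 2 * Real.pi
  have ha : ‖a‖ = A := by simp [a, A, abs_of_pos Real.pi_pos]
  have hA : 1 ≤ A := by simp only [A]; nlinarith [Real.pi_gt_three]
  clear_value A
  let p : ℕ → ℝ → ℂ := fun n x => (a * x) ^ n
  have hp : ∀ n x, HasDerivAt (p n) (n * a * p (n - 1) x) x := by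
    intro n x
    have h : HasDerivAt (fun x : ℝ => a * (x : ℂ)) a x := by
      simpa using (Complex.ofRealCLM.hasDerivAt (x := x)).const_mul a
    refine (h.pow n).congr_deriv ?_
    simp only [p]; ring
  have hpn : ∀ n x, |x| ≤ 1 → ‖p n x‖ ≤ A ^ n := by
    intro n x hx
    simp only [p, norm_pow, norm_mul, ha, Complex.norm_real, Real.norm_eq_abs]
    exact pow_le_pow_left₀ (by positivity) (mul_le_of_le_one_right (by positivity) hx) n
  let g : ℕ → ℝ → ℂ := fun n x => p n x * X x
  let g₁ : ℕ → ℝ → ℂ := fun n x => n * a * p (n - 1) x * X x + p n x * deriv X x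
  -- The truncated exponents are harmless: where `n - 1` or `n - 1 - 1` truncates, the factor in
  -- front vanishes.
  let g₂ : ℕ → ℝ → ℂ := fun n x =>
    (n * a * (((n - 1 : ℕ) : ℂ) * a * p (n - 1 - 1) x) * X x + n * a * p (n - 1) x * deriv X x) +
    (n * a * p (n - 1) x * deriv X x + p n x * deriv (deriv X) x)
  have dg : ∀ n x, HasDerivAt (g n) (g₁ n x) x := fun n x => (hp n x).mul (d0 x)
  have dg₁ : ∀ n x, HasDerivAt (g₁ n) (g₂ n x) x := fun n x =>
    (((hp (n - 1) x).const_mul (n * a)).mul (d0 x)).add ((hp n x).mul (d1 x))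
  have cp : ∀ n, Continuous (p n) := fun n => by simp only [p]; fun_prop
  have cX := hX.continuous
  have cX1 := hX1.continuous
  have cX2 := hX2.continuous
  have cg : ∀ n, Continuous (g n) := fun n => (cp n).mul cX
  have cg₁ : ∀ n, Continuous (g₁ n) := fun n =>
    ((continuous_const.mul (cp _)).mul cX).add ((cp n).mul cX1)
  have cg₂ : ∀ n, Continuous (g₂ n) := fun n =>
    (((continuous_const.mul (continuous_const.mul (cp _))).mul cX).add
      ((continuous_const.mul (cp _)).mul cX1)).add
    (((continuous_const.mul (cp _)).mul cX1).add ((cp n).mul cX2))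
  have zg : ∀ n x, 1 < |x| → g n x = 0 := fun n x hx => by simp [g, hX0 x hx]
  have zg₁ : ∀ n x, 1 < |x| → g₁ n x = 0 := fun n x hx => by simp [g₁, hX0 x hx, z1 x hx]
  have zg₂ : ∀ n x, 1 < |x| → g₂ n x = 0 := fun n x hx => by
    simp [g₂, hX0 x hx, z1 x hx, z2 x hx]
  have bnp : ∀ (n : ℕ) x, |x| ≤ 1 → ‖(n : ℂ) * a * p (n - 1) x‖ ≤ n * A ^ n := by
    intro n x hx
    rcases n with _ | n
    · simp
    · rw [norm_mul, norm_mul, ha, Complex.norm_natCast, pow_succ', mul_assoc]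
      exact mul_le_mul_of_nonneg_left (mul_le_mul_of_nonneg_left (hpn n x hx) (by positivity))
        (by positivity)
  have bnp2 : ∀ (n : ℕ) x, |x| ≤ 1 →
      ‖(n : ℂ) * a * (((n - 1 : ℕ) : ℂ) * a * p (n - 1 - 1) x)‖ ≤ n ^ 2 * A ^ n := by
    intro n x hx
    rcases n with _ | n
    · simp
    · rw [norm_mul, norm_mul, ha, Complex.norm_natCast, pow_succ' A]
      have h := bnp n x hx
      have h2 : (n : ℝ) * A ^ n ≤ ((n + 1 : ℕ) : ℝ) * A ^ n := by
        push_cast; nlinarith [pow_pos (by positivity : 0 < A) n]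
      calc ((n + 1 : ℕ) : ℝ) * A * ‖(n : ℂ) * a * p (n - 1) x‖
          ≤ ((n + 1 : ℕ) : ℝ) * A * (((n + 1 : ℕ) : ℝ) * A ^ n) := by gcongr; exact h.trans h2
        _ = _ := by ring
  let M := M0 + M1 + M2
  have bg : ∀ n x, ‖g n x‖ ≤ M * (A ^ n) := by
    intro n x
    by_cases hx : |x| ≤ 1
    · calc ‖g n x‖ = ‖p n x‖ * ‖X x‖ := norm_mul _ _
        _ ≤ A ^ n * M := mul_le_mul (hpn n x hx) ((hM0 x).trans (by simp only [M]; linarith))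
            (norm_nonneg _) (by positivity)
        _ = _ := mul_comm _ _
    · rw [zg n x (not_le.1 hx), norm_zero]; positivity
  have bg₂ : ∀ n x, ‖g₂ n x‖ ≤ M * ((n + 1) ^ 2 * A ^ n) := by
    intro n x
    by_cases hx : |x| ≤ 1
    · have e1 : ‖n * a * (((n - 1 : ℕ) : ℂ) * a * p (n - 1 - 1) x) * X x‖ ≤ n ^ 2 * A ^ n * M := by
        rw [norm_mul]
        exact mul_le_mul (bnp2 n x hx) ((hM0 x).trans (by simp only [M]; linarith))
          (norm_nonneg _) (by positivity)
      have e2 : ‖n * a * p (n - 1) x * deriv X x‖ ≤ n * A ^ n * M := by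
        rw [norm_mul]
        exact mul_le_mul (bnp n x hx) ((hM1 x).trans (by simp only [M]; linarith))
          (norm_nonneg _) (by positivity)
      have e3 : ‖p n x * deriv (deriv X) x‖ ≤ A ^ n * M := by
        rw [norm_mul]
        exact mul_le_mul (hpn n x hx) ((hM2 x).trans (by simp only [M]; linarith))
          (norm_nonneg _) (by positivity)
      calc ‖g₂ n x‖ ≤ (n ^ 2 * A ^ n * M + n * A ^ n * M) + (n * A ^ n * M + A ^ n * M) :=
            (norm_add_le _ _).trans (add_le_add ((norm_add_le _ _).trans (add_le_add e1 e2))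
              ((norm_add_le _ _).trans (add_le_add e2 e3)))
        _ = _ := by ring
    · rw [zg₂ n x (not_le.1 hx), norm_zero]; positivity
  have Ig := fun n => integral_norm_le_of_support_Icc (cg n) (bg n) (zg n)
  have Ig₂ := fun n => integral_norm_le_of_support_Icc (cg₂ n) (bg₂ n) (zg₂ n)
  have Ig₁ : ∀ n, Integrable (g₁ n) := by
    intro n
    obtain ⟨A', hA'⟩ := hbdd _ (cg₁ n) (zg₁ n)
    exact (integral_norm_le_of_support_Icc (cg₁ n) hA' (zg₁ n)).1
  have hgs : ∀ n, (fun x : ℝ => (-2 * Real.pi * Complex.I * x) • g n x) = g (n + 1) := by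
    intro n; funext x; simp only [g, p, a, smul_eq_mul, pow_succ']; ring
  have hd : ∀ n x, HasDerivAt (𝓕 (g n)) (𝓕 (g (n + 1)) x) x := by
    intro n x
    have hx : Integrable (fun x : ℝ => x • g n x) := by
      have hc : Continuous (fun x : ℝ => x • g n x) := continuous_id.smul (cg n)
      have hz : ∀ x : ℝ, 1 < |x| → x • g n x = 0 := fun x hx => by rw [zg n x hx, smul_zero]
      obtain ⟨A', hA'⟩ := hbdd _ hc hz
      exact (integral_norm_le_of_support_Icc hc hA' hz).1
    have := Real.hasDerivAt_fourier (Ig n).1 hx x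
    rwa [hgs] at this
  have hdecay := fun n => norm_fourier_le_of_hasDerivAt (Ig n).1 (Ig₁ n) (Ig₂ n).1 (dg n) (dg₁ n)
  have hcont : ∀ n, Continuous (𝓕 (g n)) := fun n =>
    continuous_iff_continuousAt.2 fun x => (hd n x).continuousAt
  have hint : ∀ n, Integrable (𝓕 (g n)) := fun n =>
    Integrable.mono' (integrable_inv_one_add_sq.const_mul _) (hcont n).aestronglyMeasurable
      (Eventually.of_forall (hdecay n))
  -- Two derivatives of `g n` cost the factor `(n + 1) ^ 2 ≤ 4 ^ n`, which turns the ratio `A` into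
  -- `4 * A`; `π` is the integral of `(1 + x ^ 2)⁻¹`.
  refine ⟨fun n => 𝓕 (g n), 4 * M * Real.pi, 4 * A, by positivity, by linarith, hd, hint, ?_, ?_⟩
  · intro n
    have hn : ((n : ℝ) + 1) ^ 2 ≤ 4 ^ n := by
      have h : ((n : ℝ) + 1) ≤ 2 ^ n := by exact_mod_cast Nat.lt_two_pow_self (n := n)
      calc ((n : ℝ) + 1) ^ 2 ≤ (2 ^ n) ^ 2 := by gcongr
        _ = 4 ^ n := by rw [← pow_mul, mul_comm, pow_mul]; norm_num
    have hn1 : (1 : ℝ) ≤ 4 ^ n := one_le_pow₀ (by norm_num)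
    have hAn : 0 < A ^ n := by positivity
    have hMn : 0 ≤ M := by positivity
    calc ∫ x, ‖𝓕 (g n) x‖
        ≤ ∫ x, ((∫ y, ‖g n y‖) + ∫ y, ‖g₂ n y‖) * (1 + x ^ 2)⁻¹ :=
          integral_mono (hint n).norm (integrable_inv_one_add_sq.const_mul _) (hdecay n)
      _ = ((∫ y, ‖g n y‖) + ∫ y, ‖g₂ n y‖) * Real.pi := by
          rw [integral_const_mul, integral_univ_inv_one_add_sq]
      _ ≤ (2 * (M * (4 ^ n * A ^ n)) + 2 * (M * (4 ^ n * A ^ n))) * Real.pi := by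
          refine mul_le_mul_of_nonneg_right (add_le_add ((Ig n).2.trans ?_) ((Ig₂ n).2.trans ?_))
            Real.pi_pos.le
          · gcongr; nlinarith
          · gcongr
      _ = _ := by rw [mul_pow]; ring
  -- Fourier inversion at `0`: the mean of the kernel is `X 0 = 1`.
  · have hinv := congrFun (Continuous.fourierInv_fourier_eq (cg 0) (Ig 0).1 (hint 0)) 0
    rw [Real.fourierInv_eq'] at hinv
    simp only [inner_zero_right, mul_zero, Complex.ofReal_zero, zero_mul, Complex.exp_zero,
      one_smul] at hinv
    rw [hinv]
    have : b 0 = 1 := b.one_of_mem_closedBall (by simp [b])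
    simp [g, p, X, this]

/-- Integration by parts of a bounded function against a chain of integrable derivatives. -/
theorem integral_iteratedDeriv_mul {K : ℕ → ℝ → ℂ}
    (hK : ∀ n x, HasDerivAt (K n) (K (n + 1) x) x) (hKi : ∀ n, Integrable (K n))
    {L : ℕ} {f : ℝ → ℂ} (hf : ContDiff ℝ L f) {M : ℝ}
    (hM : ∀ l ≤ L, ∀ x, ‖iteratedDeriv l f x‖ ≤ M) (l : ℕ) (hl : l ≤ L) (n : ℕ) :
    ∫ x, iteratedDeriv l f x * K n x = (-1) ^ l * ∫ x, f x * K (n + l) x := by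
  induction l generalizing n with
  | zero => simp
  | succ l ih =>
    have hint : ∀ k ≤ L, ∀ n, Integrable (fun x => iteratedDeriv k f x * K n x) := by
      intro k hk n
      exact (hKi n).bdd_mul
        (hf.continuous_iteratedDeriv k (by exact_mod_cast hk)).aestronglyMeasurable
        (Eventually.of_forall (hM k hk))
    have hd : ∀ x, HasDerivAt (iteratedDeriv l f) (iteratedDeriv (l + 1) f x) x := by
      intro x
      rw [iteratedDeriv_succ]
      exact ((hf.differentiable_iteratedDeriv l (by exact_mod_cast hl)) x).hasDerivAt
    have h := integral_mul_deriv_eq_deriv_mul_of_integrable (fun x _ => hd x) (fun x _ => hK n x)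
      (hint l (by omega) (n + 1)) (hint (l + 1) hl n) (hint l (by omega) n)
    rw [eq_comm, neg_eq_iff_eq_neg] at h
    rw [h, ih (by omega), show n + 1 + l = n + (l + 1) by ring]
    ring

/-- A bounded continuous function that annihilates all translates and dilates of a kernel whose
mean is not zero vanishes. -/
theorem eq_zero_of_integral_dilate_eq_zero {K : ℝ → ℂ} (hK : Integrable K)
    (hK0 : ∫ x, K x ≠ 0) {f : ℝ → ℂ} (hf : Continuous f) {M : ℝ} (hM : ∀ x, ‖f x‖ ≤ M) (x₀ : ℝ)
    (h : ∀ N : ℕ, ∫ y, f y * K (((N : ℝ) + 1) * (y - x₀)) = 0) : f x₀ = 0 := by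
  have h1 : ∀ N : ℕ, ∫ z, f (x₀ + z / ((N : ℝ) + 1)) * K z = 0 := by
    intro N
    have hN : (N : ℝ) + 1 ≠ 0 := by positivity
    have e1 := Measure.integral_comp_mul_left
      (fun z => f (x₀ + z / ((N : ℝ) + 1)) * K z) ((N : ℝ) + 1)
    have e2 := integral_sub_right_eq_self (μ := volume)
      (fun y => f (x₀ + ((N : ℝ) + 1) * y / ((N : ℝ) + 1)) * K (((N : ℝ) + 1) * y)) x₀
    have e3 : (fun y => f (x₀ + ((N : ℝ) + 1) * (y - x₀) / ((N : ℝ) + 1)) *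
        K (((N : ℝ) + 1) * (y - x₀))) = fun y => f y * K (((N : ℝ) + 1) * (y - x₀)) := by
      funext y
      rw [mul_div_cancel_left₀ _ hN, add_sub_cancel]
    rw [e3, h N] at e2
    rw [← e2] at e1
    have := smul_eq_zero.1 e1.symm
    exact this.resolve_left (by positivity)
  -- The rescaled kernel concentrates at `x₀`; dominated convergence gives `f x₀ * ∫ K` in the
  -- limit.
  have h2 : Tendsto (fun N : ℕ => ∫ z, f (x₀ + z / ((N : ℝ) + 1)) * K z) atTop
      (𝓝 (∫ z, f x₀ * K z)) := by
    refine tendsto_integral_of_dominated_convergence (fun z => M * ‖K z‖) (fun N => ?_)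
      (hK.norm.const_mul M) (fun N => Eventually.of_forall fun z => ?_)
      (Eventually.of_forall fun z => ?_)
    · exact (by fun_prop : Continuous fun z => f (x₀ + z / ((N : ℝ) + 1))).aestronglyMeasurable.mul
        hK.aestronglyMeasurable
    · rw [norm_mul]
      exact mul_le_mul_of_nonneg_right (hM _) (norm_nonneg _)
    · refine Tendsto.mul_const _ ((hf.tendsto x₀).comp ?_)
      have : Tendsto (fun N : ℕ => z * (1 / ((N : ℝ) + 1))) atTop (𝓝 (z * 0)) :=
        tendsto_one_div_add_atTop_nhds_zero_nat.const_mul z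
      simpa [div_eq_mul_inv] using this.const_add x₀
  simp only [h1] at h2
  have h3 := tendsto_nhds_unique tendsto_const_nhds h2
  rw [integral_const_mul] at h3
  exact (mul_eq_zero.1 h3.symm).resolve_right hK0

/-! ### Uniqueness for linear systems with constant coefficients -/

section Uniqueness

variable {ι : Type*} [Fintype ι] {L : ℕ} {A : ι → ι → ℕ → ℂ} {w : ι → ℝ → ℝ → ℂ}

/-- Moments of a bounded solution of a linear system against the derivatives of a band-limited
kernel vanish if they vanish initially. -/
theorem moment_eq_zero
    (hc : ∀ i t, ContDiff ℝ L (fun x => w i x t))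
    (hb : ∀ T : ℝ, ∃ M : ℝ, ∀ i, ∀ t ≤ T, ∀ l ≤ L, ∀ x,
      ‖iteratedDeriv l (fun y => w i y t) x‖ ≤ M)
    (hd : ∀ i x t, HasDerivAt (fun s => w i x s)
      (∑ j, ∑ l ∈ Finset.range (L + 1), A i j l * iteratedDeriv l (fun y => w j y t) x) t)
    (h0 : ∀ i x, w i x 0 = 0)
    {K : ℕ → ℝ → ℂ} {C B : ℝ} (hC : 0 ≤ C) (hB : 1 ≤ B)
    (hK : ∀ n x, HasDerivAt (K n) (K (n + 1) x) x) (hKi : ∀ n, Integrable (K n))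
    (hKb : ∀ n, ∫ x, ‖K n x‖ ≤ C * B ^ n) (i : ι) (n : ℕ) {T : ℝ} (hT : 0 ≤ T) :
    ∫ x, w i x T * K n x = 0 := by
  -- The extra unit of time leaves a neighbourhood of `t = T` for differentiation under the
  -- integral.
  obtain ⟨M', hM'⟩ := hb (T + 1)
  let M := max M' 0
  have hM : ∀ i, ∀ t ≤ T + 1, ∀ l ≤ L, ∀ x, ‖iteratedDeriv l (fun y => w i y t) x‖ ≤ M :=
    fun i t ht l hl x => (hM' i t ht l hl x).trans (le_max_left _ _)
  have hM0 : 0 ≤ M := le_max_right _ _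
  have hw : ∀ i, ∀ t ≤ T + 1, ∀ x, ‖w i x t‖ ≤ M := fun i t ht x => by
    simpa using hM i t ht 0 (Nat.zero_le _) x
  have hDcont : ∀ i t, ∀ l ≤ L, Continuous (iteratedDeriv l (fun y => w i y t)) :=
    fun i t l hl => (hc i t).continuous_iteratedDeriv l (by exact_mod_cast hl)
  have hDint : ∀ i, ∀ t ≤ T + 1, ∀ l ≤ L, ∀ n,
      Integrable (fun x => iteratedDeriv l (fun y => w i y t) x * K n x) := fun i t ht l hl n =>
    (hKi n).bdd_mul (hDcont i t l hl).aestronglyMeasurable (Eventually.of_forall (hM i t ht l hl))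
  let φ : ι → ℕ → ℝ → ℂ := fun i n t => ∫ x, w i x t * K n x
  let S : ℝ := ∑ i, ∑ j, ∑ l ∈ Finset.range (L + 1), ‖A i j l‖
  let Si : ι → ℝ := fun i => ∑ j, ∑ l ∈ Finset.range (L + 1), ‖A i j l‖
  have hSi0 : ∀ i, 0 ≤ Si i := fun i =>
    Finset.sum_nonneg fun j _ => Finset.sum_nonneg fun l _ => norm_nonneg _
  have hSi : ∀ i, Si i ≤ S := fun i =>
    Finset.single_le_sum (f := Si) (fun i _ => hSi0 i) (Finset.mem_univ i)
  have hS : 0 ≤ S := Finset.sum_nonneg fun i _ => hSi0 i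
  -- Integration by parts moves `l ≤ L` derivatives onto the kernel, so the moments satisfy a closed
  -- system that raises `n` by at most `L`.
  have hφd : ∀ i n, ∀ t < T + 1, HasDerivAt (φ i n)
      (∑ j, ∑ l ∈ Finset.range (L + 1), A i j l * ((-1) ^ l * φ j (n + l) t)) t := by
    intro i n t ht
    let F' : ℝ → ℝ → ℂ := fun s x =>
      (∑ j, ∑ l ∈ Finset.range (L + 1), A i j l * iteratedDeriv l (fun y => w j y s) x) * K n x
    have hF : ∀ s, F' s = fun x => ∑ j, ∑ l ∈ Finset.range (L + 1),
        A i j l * (iteratedDeriv l (fun y => w j y s) x * K n x) := by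
      intro s; funext x
      simp only [F', Finset.sum_mul, mul_assoc]
    have hle : ∀ l ∈ Finset.range (L + 1), l ≤ L := fun l hl =>
      Nat.lt_succ_iff.1 (Finset.mem_range.1 hl)
    have hFi : Integrable (F' t) := by
      rw [hF]
      exact integrable_finsetSum _ fun j _ => integrable_finsetSum _ fun l hl =>
        (hDint j t ht.le l (hle l hl) n).const_mul _
    have key := hasDerivAt_integral_of_dominated_loc_of_deriv_le (μ := volume)
      (F := fun s x => w i x s * K n x) (F' := F') (x₀ := t) (s := Set.Iio (T + 1))
      (bound := fun x => S * M * ‖K n x‖) (Iio_mem_nhds ht)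
      (Eventually.of_forall fun s => ((hc i s).continuous.aestronglyMeasurable).mul
        (hKi n).aestronglyMeasurable)
      (by simpa using hDint i t ht.le 0 (Nat.zero_le _) n)
      hFi.aestronglyMeasurable
      (Eventually.of_forall fun x s hs => by
        rw [norm_mul]
        refine mul_le_mul_of_nonneg_right ?_ (norm_nonneg _)
        calc ‖∑ j, ∑ l ∈ Finset.range (L + 1), A i j l * iteratedDeriv l (fun y => w j y s) x‖
            ≤ ∑ j, ∑ l ∈ Finset.range (L + 1), ‖A i j l‖ * M := by
              refine norm_sum_le_of_le _ fun j _ => norm_sum_le_of_le _ fun l hl => ?_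
              rw [norm_mul]
              exact mul_le_mul_of_nonneg_left (hM j s (le_of_lt hs) l (hle l hl) x)
                (norm_nonneg _)
          _ = Si i * M := by simp only [Si, Finset.sum_mul]
          _ ≤ S * M := mul_le_mul_of_nonneg_right (hSi i) hM0)
      ((hKi n).norm.const_mul _)
      (Eventually.of_forall fun x s _ => (hd i x s).mul_const _)
    refine key.2.congr_deriv ?_
    rw [hF, integral_finsetSum _ fun j _ => integrable_finsetSum _ fun l hl =>
        (hDint j t ht.le l (hle l hl) n).const_mul _]
    refine Finset.sum_congr rfl fun j _ => ?_
    rw [integral_finsetSum _ fun l hl => (hDint j t ht.le l (hle l hl) n).const_mul _]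
    refine Finset.sum_congr rfl fun l hl => ?_
    rw [integral_const_mul,
      integral_iteratedDeriv_mul hK hKi (hc j t) (hM j t ht.le) l (hle l hl) n]
  let D : ℝ := S * B ^ L
  have hBp : 0 < B := by linarith
  have hD : 0 ≤ D := by positivity
  -- Each integration in time costs `S` from the coefficients and at most `B ^ L` from the shift of
  -- `n`, hence `D`.
  have hφ : ∀ p : ℕ, ∀ i n, ∀ t ∈ Set.Icc (0 : ℝ) T,
      ‖φ i n t‖ ≤ M * C * B ^ n * ((D * t) ^ p / p.factorial) := by
    intro p
    induction p with
    | zero =>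
      intro i n t ht
      calc ‖φ i n t‖ ≤ ∫ x, ‖w i x t * K n x‖ := norm_integral_le_integral_norm _
        _ ≤ ∫ x, M * ‖K n x‖ := by
          refine integral_mono ?_ ((hKi n).norm.const_mul _) fun x => ?_
          · simpa using (hDint i t (by linarith [ht.2]) 0 (Nat.zero_le _) n).norm
          · simp only [norm_mul]
            exact mul_le_mul_of_nonneg_right (hw i t (by linarith [ht.2]) x) (norm_nonneg _)
        _ = M * ∫ x, ‖K n x‖ := integral_const_mul _ _
        _ ≤ M * (C * B ^ n) := mul_le_mul_of_nonneg_left (hKb n) hM0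
        _ = _ := by simp; ring
    | succ p ih =>
      intro i n t ht
      refine image_norm_le_of_norm_deriv_right_le_deriv_boundary
        (f := φ i n) (a := 0) (b := T)
        (B := fun t => M * C * B ^ n * ((D * t) ^ (p + 1) / (p + 1).factorial))
        (B' := fun t => M * C * B ^ n * (D * ((D * t) ^ p / p.factorial)))
        (fun s hs => (hφd i n s (by linarith [hs.2])).continuousAt.continuousWithinAt)
        (fun s hs => (hφd i n s (by linarith [hs.2])).hasDerivWithinAt) ?_ ?_ ?_ ht
      · simp [φ, h0]
      · intro s
        have h1 : HasDerivAt (fun t : ℝ => D * t) D s := by simpa using (hasDerivAt_id s).const_mul D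
        refine (((h1.pow (p + 1)).div_const _).const_mul _).congr_deriv ?_
        have : ((p + 1).factorial : ℝ) = (p + 1) * p.factorial := by
          rw [Nat.factorial_succ]; push_cast; ring
        rw [this]
        have hp : (p.factorial : ℝ) ≠ 0 := by positivity
        have hp1 : (p : ℝ) + 1 ≠ 0 := by positivity
        simp only [Nat.add_sub_cancel]
        push_cast
        field_simp
      · intro s hs
        have hQ : 0 ≤ (D * s) ^ p / p.factorial := by have := hs.1; positivity
        calc ‖∑ j, ∑ l ∈ Finset.range (L + 1), A i j l * ((-1) ^ l * φ j (n + l) s)‖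
            ≤ ∑ j, ∑ l ∈ Finset.range (L + 1),
              ‖A i j l‖ * (M * C * (B ^ n * B ^ L) * ((D * s) ^ p / p.factorial)) := by
              refine norm_sum_le_of_le _ fun j _ => norm_sum_le_of_le _ fun l hl => ?_
              rw [norm_mul, norm_mul, norm_pow, norm_neg, norm_one, one_pow, one_mul]
              refine mul_le_mul_of_nonneg_left ?_ (norm_nonneg _)
              refine (ih j (n + l) s ⟨hs.1, hs.2.le⟩).trans ?_
              rw [pow_add]
              have : B ^ l ≤ B ^ L :=
                pow_le_pow_right₀ hB (Nat.lt_succ_iff.1 (Finset.mem_range.1 hl))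
              gcongr
          _ = Si i * (M * C * (B ^ n * B ^ L) * ((D * s) ^ p / p.factorial)) := by
              simp only [Si, Finset.sum_mul]
          _ ≤ S * (M * C * (B ^ n * B ^ L) * ((D * s) ^ p / p.factorial)) := by
              gcongr; exact hSi i
          _ = _ := by simp only [D]; ring
  have hlim : Tendsto (fun p : ℕ => M * C * B ^ n * ((D * T) ^ p / p.factorial)) atTop
      (𝓝 (M * C * B ^ n * 0)) :=
    (FloorSemiring.tendsto_pow_div_factorial_atTop (D * T)).const_mul _
  rw [mul_zero] at hlim
  have := ge_of_tendsto' hlim fun p => hφ p i n T ⟨hT, le_rfl⟩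
  exact norm_le_zero_iff.1 this

/-- No hyperbolicity is required: the geometric growth of the kernel's derivatives lets `∂ₓ` act
like a bounded operator on moments. Translating the kernel to `x` and dilating it by `R` preserves
the derivative chain and only replaces `B` by `R * B`, so all dilated moments vanish. -/
theorem eq_zero_of_hasDerivAt
    (hc : ∀ i t, ContDiff ℝ L (fun x => w i x t))
    (hb : ∀ T : ℝ, ∃ M : ℝ, ∀ i, ∀ t ≤ T, ∀ l ≤ L, ∀ x,
      ‖iteratedDeriv l (fun y => w i y t) x‖ ≤ M)
    (hd : ∀ i x t, HasDerivAt (fun s => w i x s)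
      (∑ j, ∑ l ∈ Finset.range (L + 1), A i j l * iteratedDeriv l (fun y => w j y t) x) t)
    (h0 : ∀ i x, w i x 0 = 0) (i : ι) (x : ℝ) {t : ℝ} (ht : 0 ≤ t) : w i x t = 0 := by
  obtain ⟨K, C, B, hC, hB, hK, hKi, hKb, hK0⟩ := exists_bandlimited_kernel
  obtain ⟨M, hM⟩ := hb t
  refine eq_zero_of_integral_dilate_eq_zero (hKi 0) hK0 (hc i t).continuous (M := M)
    (fun y => by simpa using hM i t le_rfl 0 (Nat.zero_le _) y) x fun N => ?_
  let R : ℝ := (N : ℝ) + 1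
  have hR : 1 ≤ R := by simp [R]
  have hR0 : 0 < R := by linarith
  have := moment_eq_zero hc hb hd h0 (K := fun n y => (R : ℂ) ^ n * K n (R * (y - x))) hC
    (B := R * B) (by nlinarith) ?_ ?_ ?_ i 0 ht
  · simpa [R] using this
  · intro n y
    have h1 : HasDerivAt (fun y : ℝ => R * (y - x)) R y := by
      simpa using ((hasDerivAt_id y).sub_const x).const_mul R
    refine (((hK n (R * (y - x))).scomp y h1).const_mul ((R : ℂ) ^ n)).congr_deriv ?_
    rw [Complex.real_smul]; ring
  · intro n
    exact (((hKi n).comp_mul_left' hR0.ne').comp_sub_right x).const_mul _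
  · intro n
    have e1 := Measure.integral_comp_mul_left (fun z => ‖K n z‖) R
    have e2 := integral_sub_right_eq_self (μ := volume) (fun y => ‖K n (R * y)‖) x
    have hn0 : 0 ≤ ∫ z, ‖K n z‖ := integral_nonneg fun _ => norm_nonneg _
    have hRi : |R⁻¹| ≤ 1 := by rw [abs_of_pos (by positivity)]; exact inv_le_one_of_one_le₀ hR
    simp only [norm_mul, norm_pow, Complex.norm_real, Real.norm_eq_abs, abs_of_pos hR0]
    rw [integral_const_mul, e2, e1, smul_eq_mul, mul_pow]
    calc R ^ n * (|R⁻¹| * ∫ z, ‖K n z‖) ≤ R ^ n * (1 * (C * B ^ n)) := by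
          gcongr; exact hKb n
      _ = _ := by ring

/-- Uniqueness of bounded classical solutions of linear systems with constant coefficients. -/
theorem eq_zero_of_hasDerivWithinAt
    (hc : ∀ i t, 0 ≤ t → ContDiff ℝ L (fun x => w i x t))
    (hb : ∀ T : ℝ, ∃ M : ℝ, ∀ i t, 0 ≤ t → t ≤ T → ∀ l ≤ L, ∀ x,
      ‖iteratedDeriv l (fun y => w i y t) x‖ ≤ M)
    (hd : ∀ i x t, 0 ≤ t → HasDerivWithinAt (fun s => w i x s)
      (∑ j, ∑ l ∈ Finset.range (L + 1), A i j l * iteratedDeriv l (fun y => w j y t) x)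
      (Set.Ici 0) t)
    (h0 : ∀ i x, w i x 0 = 0) (i : ι) (x : ℝ) {t : ℝ} (ht : 0 ≤ t) : w i x t = 0 := by
  -- Extend by zero to negative times through `max t 0`. At `t = 0` the right-hand side vanishes
  -- with the data, so the one-sided derivatives agree.
  have hz : ∀ s ≤ (0 : ℝ), ∀ i x, w i x (max s 0) = 0 := fun s hs i x => by
    rw [max_eq_right hs, h0]
  have hzd : ∀ s ≤ (0 : ℝ), ∀ i x, (∑ j, ∑ l ∈ Finset.range (L + 1),
      A i j l * iteratedDeriv l (fun y => w j y (max s 0)) x) = 0 := by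
    intro s hs i x
    simp [hz s hs]
  have := eq_zero_of_hasDerivAt (w := fun i x t => w i x (max t 0)) (A := A) (L := L)
    (fun i t => hc i _ (le_max_right _ _)) ?_ ?_ (fun i x => by simp [h0]) i x ht
  · simpa [ht] using this
  · intro T
    obtain ⟨M, hM⟩ := hb (max T 0)
    exact ⟨M, fun i t ht l hl x =>
      hM i _ (le_max_right _ _) (max_le_max_right 0 ht) l hl x⟩
  · intro i x t
    rcases lt_trichotomy t 0 with h | h | h
    · rw [hzd t h.le]
      refine (hasDerivAt_const t (0 : ℂ)).congr_of_eventuallyEq ?_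
      filter_upwards [Iio_mem_nhds h] with s hs
      exact hz s (le_of_lt hs) i x
    · subst h
      have h1 := hd i x 0 le_rfl
      have hzd' := hzd 0 le_rfl i x
      simp only [max_self] at hzd'
      simp only [max_self]
      rw [hzd'] at h1 ⊢
      have h2 : HasDerivWithinAt (fun s => w i x (max s 0)) 0 (Set.Ici 0) 0 :=
        h1.congr (fun s hs => by simp only [max_eq_left (Set.mem_Ici.1 hs)]) (by simp)
      have h3 : HasDerivWithinAt (fun s => w i x (max s 0)) 0 (Set.Iic 0) 0 :=
        (hasDerivWithinAt_const 0 _ (0 : ℂ)).congr (fun s hs => hz s hs i x) (hz 0 le_rfl i x)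
      have h4 := h3.union h2
      rwa [Set.Iic_union_Ici, hasDerivWithinAt_univ] at h4
    · have h1 := (hd i x t h.le).hasDerivAt (Ici_mem_nhds h)
      simp only [max_eq_left h.le]
      refine h1.congr_of_eventuallyEq ?_
      filter_upwards [Ioi_mem_nhds h] with s hs
      rw [max_eq_left (le_of_lt hs)]

end Uniqueness

/-! ### Sign structure: symmetry and dissipation -/

section Signs

variable {m : ℕ} {σ₀ : ℝ}

theorem AdmissibleSign.sq_eq_one (hσ : AdmissibleSign m σ₀) : σ₀ ^ 2 = 1 := by
  rcases Nat.even_or_odd m with h | h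
  · rw [hσ.2 h, ← pow_mul, mul_comm, pow_mul]; norm_num
  · rcases hσ.1 h with h | h <;> rw [h] <;> norm_num

theorem AdmissibleSign.stableSign_sq (hσ : AdmissibleSign m σ₀) (j : ℕ) :
    stableSign m σ₀ j ^ 2 = 1 := by
  have h : ∀ n : ℕ, (σ₀ * (-1) ^ n) ^ 2 = 1 := fun n => by
    rw [mul_pow, hσ.sq_eq_one, ← pow_mul, mul_comm n, pow_mul]; norm_num
  unfold stableSign
  split_ifs <;> exact h _

theorem stableSign_zero (hm : 1 ≤ m) : stableSign m σ₀ 0 = σ₀ := by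
  simp [stableSign, show 0 < m from hm]

/-- The derivative terms couple `j` with `m - 1 - j`, including `j = 0` with `s₀ = σ₀`; equal signs
make that antidiagonal matrix symmetric. -/
theorem stableSign_reflect {j : ℕ} (hj : j < m) :
    stableSign m σ₀ (m - 1 - j) = stableSign m σ₀ j := by
  unfold stableSign
  split_ifs with h1 h2 h2
  · rw [show m - 1 - j = j by omega]
  · rw [show m - 1 - j = m - j - 1 by omega]
  · rw [show m - (m - 1 - j) - 1 = j by omega]
  · omega

/-- The relaxation terms couple `j` with `m - j`; opposite signs make their contributions to the
energy cancel in pairs. -/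
theorem stableSign_add {j : ℕ} (h1 : 1 ≤ j) (hj : j < m) (h : 2 * j ≠ m) :
    stableSign m σ₀ j + stableSign m σ₀ (m - j) = 0 := by
  unfold stableSign
  split_ifs with h2 h3 h3
  · omega
  · obtain ⟨i, rfl⟩ : ∃ i, j = i + 1 := ⟨j - 1, by omega⟩
    rw [show m - (m - (i + 1)) - 1 = i by omega, pow_succ]; ring
  · obtain ⟨i, hi⟩ : ∃ i, m - j = i + 1 := ⟨m - j - 1, by omega⟩
    rw [hi, Nat.add_sub_cancel, pow_succ]; ring
  · omega

/-- The self-coupled component exists only for even `m`. There `σ₀ = (-1) ^ (m / 2)` is what gives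
damping rather than growth. -/
theorem AdmissibleSign.stableSign_half (hσ : AdmissibleSign m σ₀) {j : ℕ} (h1 : 1 ≤ j)
    (h : 2 * j = m) : stableSign m σ₀ j = -1 := by
  have hs := hσ.2 ⟨j, by omega⟩
  rw [show m / 2 = j by omega] at hs
  unfold stableSign
  rw [if_neg (by omega), hs, show m - j - 1 = j - 1 by omega]
  obtain ⟨i, rfl⟩ : ∃ i, j = i + 1 := ⟨j - 1, by omega⟩
  rw [Nat.add_sub_cancel, pow_succ, mul_right_comm, ← pow_add, ← two_mul, pow_mul]
  norm_num

/-- The principal part of the stable hyperbolization is symmetric. -/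
theorem sum_stableSign_antidiagonal_eq_zero (k : ℝ) (z : ℕ → ℂ) :
    ∑ j ∈ Finset.range m,
      stableSign m σ₀ j * (conj (z j) * (Complex.I * k * z (m - 1 - j))).re = 0 := by
  have h := Finset.sum_range_reflect (fun j =>
    stableSign m σ₀ j * (conj (z j) * (Complex.I * k * z (m - 1 - j))).re) m
  -- Exchanging the two factors reverses the sign of the real part because `i k` is imaginary, so
  -- the reflected sum is its own negative.
  have h2 : ∑ j ∈ Finset.range m, stableSign m σ₀ (m - 1 - j) *
      (conj (z (m - 1 - j)) * (Complex.I * k * z (m - 1 - (m - 1 - j)))).re =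
      -∑ j ∈ Finset.range m,
        stableSign m σ₀ j * (conj (z j) * (Complex.I * k * z (m - 1 - j))).re := by
    rw [← Finset.sum_neg_distrib]
    refine Finset.sum_congr rfl fun j hj => ?_
    have hj := Finset.mem_range.1 hj
    rw [stableSign_reflect hj, show m - 1 - (m - 1 - j) = j by omega]
    simp
    ring
  linarith [h.symm.trans h2]

/-- The relaxation part of the stable hyperbolization is dissipative. -/
theorem AdmissibleSign.sum_stableSign_le_zero (hσ : AdmissibleSign m σ₀) (z : ℕ → ℂ) :
    ∑ j ∈ Finset.Ico 1 m, stableSign m σ₀ j * (conj (z j) * z (m - j)).re ≤ 0 := by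
  have h : ∑ j ∈ Finset.Ico 1 m, stableSign m σ₀ j * (conj (z j) * z (m - j)).re =
      ∑ j ∈ Finset.Ico 1 m, stableSign m σ₀ (m - j) * (conj (z (m - j)) * z j).re := by
    refine Finset.sum_nbij' (fun j => m - j) (fun j => m - j) ?_ ?_ ?_ ?_ ?_
    · intro j hj; simp only [Finset.mem_Ico] at hj ⊢; omega
    · intro j hj; simp only [Finset.mem_Ico] at hj ⊢; omega
    · intro j hj; simp only [Finset.mem_Ico] at hj; omega
    · intro j hj; simp only [Finset.mem_Ico] at hj; omega
    · intro j hj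
      simp only [Finset.mem_Ico] at hj
      rw [show m - (m - j) = j by omega]
  have h2 : ∑ j ∈ Finset.Ico 1 m, (stableSign m σ₀ j * (conj (z j) * z (m - j)).re +
      stableSign m σ₀ (m - j) * (conj (z (m - j)) * z j).re) ≤ 0 := by
    refine Finset.sum_nonpos fun j hj => ?_
    obtain ⟨h1, hj⟩ := Finset.mem_Ico.1 hj
    by_cases hjm : 2 * j = m
    · rw [show m - j = j by omega, hσ.stableSign_half h1 hjm]
      simp
      nlinarith [mul_self_nonneg (z j).re, mul_self_nonneg (z j).im]
    · have e : (conj (z (m - j)) * z j).re = (conj (z j) * z (m - j)).re := by simp; ring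
      rw [e, ← add_mul, stableSign_add h1 hj hjm, zero_mul]
  rw [Finset.sum_add_distrib] at h2
  linarith

end Signs

/-! ### Energy estimate and relaxation limit of one mode -/

/-- The energy `|e₀|² + τ ∑ⱼ |eⱼ|²` of a Fourier mode of the stable hyperbolization with source
terms `τ² rⱼ` that are bounded on `[0, T]`. -/
theorem AdmissibleSign.energy_estimate {m : ℕ} (hm : 1 ≤ m) {σ₀ : ℝ} (hσ : AdmissibleSign m σ₀)
    (k : ℝ) {τ : ℝ} (hτ : 0 < τ) {e r : ℕ → ℝ → ℂ}
    (h0 : ∀ t, HasDerivAt (e 0) (-(σ₀ * (Complex.I * k * e (m - 1) t))) t)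
    (hj : ∀ j, 1 ≤ j → j < m → ∀ t, HasDerivAt (e j)
      (((stableSign m σ₀ j / τ : ℝ) : ℂ) * (e (m - j) t - Complex.I * k * e (m - j - 1) t)
        - τ * r j t) t)
    {T : ℝ} (hT : 0 ≤ T) {R K : ℝ}
    (hR : ∀ t ∈ Set.Icc 0 T, ∑ j ∈ Finset.Ico 1 m, ‖r j t‖ ^ 2 ≤ R)
    (hK : ‖e 0 0‖ ^ 2 + τ * ∑ j ∈ Finset.Ico 1 m, ‖e j 0‖ ^ 2 ≤ K * τ ^ 3) :
    ‖e 0 T‖ ^ 2 ≤ Real.exp T * ((K + R) * τ ^ 3) := by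
  let E : ℝ → ℝ := fun t => ‖e 0 t‖ ^ 2 + τ * ∑ j ∈ Finset.Ico 1 m, ‖e j t‖ ^ 2
  let E' : ℝ → ℝ := fun t => 2 * inner ℝ (e 0 t) (-(σ₀ * (Complex.I * k * e (m - 1) t))) +
    τ * ∑ j ∈ Finset.Ico 1 m, 2 * inner ℝ (e j t)
      (((stableSign m σ₀ j / τ : ℝ) : ℂ) * (e (m - j) t - Complex.I * k * e (m - j - 1) t)
        - τ * r j t)
  have hE : ∀ t, HasDerivAt E (E' t) t := fun t =>
    (h0 t).norm_sq.add ((HasDerivAt.fun_sum fun j hj' =>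
      (hj j (Finset.mem_Ico.1 hj').1 (Finset.mem_Ico.1 hj').2 t).norm_sq).const_mul τ)
  have hE' : ∀ t ∈ Set.Icc 0 T, E' t ≤ E t + R * τ ^ 3 := by
    intro t ht
    let a : ℕ → ℝ := fun j => stableSign m σ₀ j *
      (conj (e j t) * (Complex.I * k * e (m - 1 - j) t)).re
    let b : ℕ → ℝ := fun j => stableSign m σ₀ j * (conj (e j t) * e (m - j) t).re
    have ha : ∑ j ∈ Finset.range m, a j = 0 :=
      sum_stableSign_antidiagonal_eq_zero k fun j => e j t
    have hb : ∑ j ∈ Finset.Ico 1 m, b j ≤ 0 := hσ.sum_stableSign_le_zero fun j => e j t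
    rw [Finset.range_eq_Ico, Finset.sum_eq_sum_Ico_succ_bot (by omega)] at ha
    have hfirst : inner ℝ (e 0 t) (-(σ₀ * (Complex.I * k * e (m - 1) t))) = -a 0 := by
      simp only [a, Complex.inner, stableSign_zero hm, Nat.sub_zero]
      simp
      ring
    have hterm : ∀ j ∈ Finset.Ico 1 m, τ * (2 * inner ℝ (e j t)
        (((stableSign m σ₀ j / τ : ℝ) : ℂ) * (e (m - j) t - Complex.I * k * e (m - j - 1) t)
          - τ * r j t)) ≤ 2 * b j - 2 * a j + (τ * ‖e j t‖ ^ 2 + τ ^ 3 * ‖r j t‖ ^ 2) := by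
      intro j _
      have e1 : inner ℝ (e j t) (((stableSign m σ₀ j / τ : ℝ) : ℂ) *
          (e (m - j) t - Complex.I * k * e (m - j - 1) t) - τ * r j t) =
          (b j - a j) / τ - τ * inner ℝ (e j t) (r j t) := by
        simp only [a, b, Complex.inner, show m - 1 - j = m - j - 1 by omega]
        rw [sub_mul, Complex.sub_re, mul_assoc (τ : ℂ), Complex.re_ofReal_mul,
          show ((stableSign m σ₀ j / τ : ℝ) : ℂ) *
            (e (m - j) t - Complex.I * k * e (m - j - 1) t) * conj (e j t) =
            ((stableSign m σ₀ j / τ : ℝ) : ℂ) * (conj (e j t) * e (m - j) t -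
              conj (e j t) * (Complex.I * k * e (m - j - 1) t)) by ring,
          Complex.re_ofReal_mul, Complex.sub_re]
        ring
      have e2 : -inner ℝ (e j t) (r j t) ≤ ‖e j t‖ * ‖r j t‖ :=
        (neg_le_abs _).trans (abs_real_inner_le_norm _ _)
      rw [e1]
      have e3 : τ * (2 * ((b j - a j) / τ - τ * inner ℝ (e j t) (r j t))) =
          2 * b j - 2 * a j + 2 * τ ^ 2 * -inner ℝ (e j t) (r j t) := by
        field_simp; ring
      have e4 : 2 * τ ^ 2 * -inner ℝ (e j t) (r j t) ≤ 2 * τ ^ 2 * (‖e j t‖ * ‖r j t‖) := by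
        gcongr
      -- Completed square behind `2 τ² |e| |r| ≤ τ |e|² + τ³ |r|²`.
      have e5 : 0 ≤ τ * (‖e j t‖ - τ * ‖r j t‖) ^ 2 := by positivity
      rw [e3]
      linarith
    have hsum := Finset.sum_le_sum hterm
    simp only [Finset.sum_add_distrib, Finset.sum_sub_distrib, ← Finset.mul_sum] at hsum
    have hRt : τ ^ 3 * ∑ j ∈ Finset.Ico 1 m, ‖r j t‖ ^ 2 ≤ τ ^ 3 * R := by
      gcongr; exact hR t ht
    simp only [E, E', hfirst, ← Finset.mul_sum]
    have := sq_nonneg ‖e 0 t‖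
    linarith
  -- Gronwall by an integrating factor: `E' ≤ E + R τ³` makes `F` nonincreasing.
  let F : ℝ → ℝ := fun t => Real.exp (-t) * (E t + R * τ ^ 3)
  have hF : ∀ t, HasDerivAt F (-Real.exp (-t) * (E t + R * τ ^ 3) + Real.exp (-t) * E' t) t := by
    intro t
    have h1 : HasDerivAt (fun t => Real.exp (-t)) (-Real.exp (-t)) t := by
      simpa using (hasDerivAt_neg t).exp
    exact h1.mul ((hE t).add_const _)
  have hanti : AntitoneOn F (Set.Icc 0 T) := by
    refine antitoneOn_of_deriv_nonpos (convex_Icc 0 T)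
      (fun t _ => (hF t).continuousAt.continuousWithinAt)
      (fun t _ => (hF t).differentiableAt.differentiableWithinAt) fun t ht => ?_
    rw [interior_Icc] at ht
    rw [(hF t).deriv]
    have := hE' t (Set.Ioo_subset_Icc_self ht)
    nlinarith [mul_le_mul_of_nonneg_left this (Real.exp_pos (-t)).le]
  have h1 := hanti ⟨le_rfl, hT⟩ ⟨hT, le_rfl⟩ hT
  have hR0 : 0 ≤ R := (Finset.sum_nonneg fun j _ => sq_nonneg _).trans (hR 0 ⟨le_rfl, hT⟩)
  have h2 : ‖e 0 T‖ ^ 2 ≤ E T + R * τ ^ 3 := by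
    have : 0 ≤ τ * ∑ j ∈ Finset.Ico 1 m, ‖e j T‖ ^ 2 :=
      mul_nonneg hτ.le (Finset.sum_nonneg fun j _ => sq_nonneg _)
    have : 0 ≤ R * τ ^ 3 := by positivity
    simp only [E]
    linarith
  have h3 : E T + R * τ ^ 3 = Real.exp T * F T := by
    simp only [F]
    rw [← mul_assoc, ← Real.exp_add]; simp
  rw [h3] at h2
  refine h2.trans (mul_le_mul_of_nonneg_left (h1.trans ?_) (Real.exp_pos T).le)
  simp only [F, E, neg_zero, Real.exp_zero, one_mul]
  linarith

/-- The first order corrector of the relaxation limit of the mode with symbol `κ`. -/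
noncomputable def corrector (m : ℕ) (σ₀ : ℝ) (κ lam : ℂ) : ℕ → ℂ
  | 0 => 0
  | i + 1 => κ * corrector m σ₀ κ lam i + stableSign m σ₀ (m - i - 1) * lam * κ ^ (m - i - 1)

/-- A Fourier mode of the stable hyperbolization is `O(τ)` close to that of the limit equation. -/
theorem AdmissibleSign.mode_error {m : ℕ} (hm : 1 ≤ m) {σ₀ : ℝ} (hσ : AdmissibleSign m σ₀)
    (k : ℝ) (v : ℂ) {T : ℝ} (hT : 0 ≤ T) :
    ∃ C : ℝ, ∀ τ : ℝ, 0 < τ → τ ≤ 1 → ∀ p : ℕ → ℝ → ℂ,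
      (∀ t, HasDerivAt (p 0) (-(σ₀ * (Complex.I * k * p (m - 1) t))) t) →
      (∀ j, 1 ≤ j → j < m → ∀ t, HasDerivAt (p j)
        (((stableSign m σ₀ j / τ : ℝ) : ℂ) * (p (m - j) t - Complex.I * k * p (m - j - 1) t)) t) →
      (∀ j < m, p j 0 = v * (Complex.I * k) ^ j) →
      ‖p 0 T - v * Complex.exp (-(σ₀ * (Complex.I * k) ^ m) * T)‖ ≤ C * τ := by
  let κ : ℂ := Complex.I * k
  let lam : ℂ := -(σ₀ * κ ^ m)
  -- The recursion says `b (m - j) - κ b (m - j - 1) = s_j λ κ ^ j`. As `s_j ^ 2 = 1`, the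
  -- relaxation term of the ansatz then equals `λ κ ^ j U`, the leading part of its time derivative.
  let b : ℕ → ℂ := corrector m σ₀ κ lam
  -- The first-order change of the rate `λ` caused by `b`; the factor `1 + τ c t` makes the equation
  -- for the component `0` exact.
  let c : ℂ := -(σ₀ * κ * b (m - 1))
  let U : ℝ → ℂ := fun t => v * Complex.exp (lam * t)
  have hU : ∀ t, HasDerivAt U (lam * U t) t := by
    intro t
    have h1 : HasDerivAt (fun t : ℝ => lam * (t : ℂ)) lam t := by
      simpa using (Complex.ofRealCLM.hasDerivAt (x := t)).const_mul lam
    refine (h1.cexp.const_mul v).congr_deriv ?_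
    simp only [U]; ring
  have hUc : Continuous U := continuous_iff_continuousAt.2 fun t => (hU t).continuousAt
  let r : ℕ → ℝ → ℂ := fun j t => (κ ^ j * c + lam * κ ^ j * c * t + lam * b j) * U t
  have hrc : Continuous fun t => ∑ j ∈ Finset.Ico 1 m, ‖r j t‖ ^ 2 := by
    simp only [r]; fun_prop
  obtain ⟨R, hR⟩ := isCompact_Icc.exists_bound_of_continuousOn (s := Set.Icc 0 T) hrc.continuousOn
  let K : ℝ := ∑ j ∈ Finset.Ico 1 m, ‖b j * v‖ ^ 2
  have hK : 0 ≤ K := Finset.sum_nonneg fun j _ => sq_nonneg _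
  have hR0 : 0 ≤ R := (norm_nonneg _).trans (hR 0 ⟨le_rfl, hT⟩)
  refine ⟨Real.sqrt (Real.exp T * (K + R)) + ‖c * T * U T‖, fun τ hτ hτ1 p hp0 hp hpi => ?_⟩
  have hτc : (τ : ℂ) ≠ 0 := by exact_mod_cast hτ.ne'
  let a : ℕ → ℝ → ℂ := fun j t => (κ ^ j * (1 + τ * c * t) + τ * b j) * U t
  have hb0 : b 0 = 0 := rfl
  have ha : ∀ j t, HasDerivAt (a j)
      (τ * κ ^ j * c * U t + lam * a j t) t := by
    intro j t
    have h1 : HasDerivAt (fun t : ℝ => κ ^ j * (1 + τ * c * t) + τ * b j) (κ ^ j * (τ * c)) t := by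
      have := (Complex.ofRealCLM.hasDerivAt (x := t)).const_mul (τ * c)
      simpa using ((this.const_add 1).const_mul (κ ^ j)).add_const (τ * b j)
    refine (h1.mul (hU t)).congr_deriv ?_
    simp only [a]; ring
  have hen := hσ.energy_estimate hm k hτ (e := fun j t => p j t - a j t) (r := r) ?_ ?_ hT
    (R := R) (K := K) ?_ ?_
  · have h1 : ‖p 0 T - a 0 T‖ ≤ Real.sqrt (Real.exp T * (K + R)) * τ := by
      -- The energy gives order `τ ^ (3 / 2)`; `τ ≤ 1` reduces this to order `τ`.
      refine le_of_sq_le_sq ?_ (by positivity)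
      rw [mul_pow, Real.sq_sqrt (by positivity)]
      refine hen.trans ?_
      rw [← mul_assoc]
      exact mul_le_mul_of_nonneg_left (pow_le_pow_of_le_one hτ.le hτ1 (by norm_num))
        (by positivity)
    have h2 : p 0 T - v * Complex.exp (lam * T) = (p 0 T - a 0 T) + τ * (c * T * U T) := by
      simp only [a, hb0, U]; ring
    calc ‖p 0 T - v * Complex.exp (lam * T)‖
        ≤ ‖p 0 T - a 0 T‖ + ‖τ * (c * T * U T)‖ := by rw [h2]; exact norm_add_le _ _
      _ ≤ Real.sqrt (Real.exp T * (K + R)) * τ + τ * ‖c * T * U T‖ := by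
          rw [norm_mul (τ : ℂ), Complex.norm_real, Real.norm_of_nonneg hτ.le]
          gcongr
      _ = _ := by ring
  · intro t
    refine ((hp0 t).sub (ha 0 t)).congr_deriv ?_
    have e1 : κ ^ m = κ * κ ^ (m - 1) := by rw [← pow_succ', Nat.sub_add_cancel hm]
    simp only [a, hb0, lam, c, e1]
    simp only [κ]
    ring
  · intro j h1 hj t
    refine ((hp j h1 hj t).sub (ha j t)).congr_deriv ?_
    obtain ⟨i, hi⟩ : ∃ i, m - j = i + 1 := ⟨m - j - 1, by omega⟩
    have hb : b (m - j) = κ * b i + stableSign m σ₀ j * lam * κ ^ j := by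
      rw [hi]
      simp only [b]
      rw [corrector, show m - i - 1 = j by omega]
    have hs : ((stableSign m σ₀ j : ℝ) : ℂ) * stableSign m σ₀ j = 1 := by
      rw [← Complex.ofReal_mul, ← sq, hσ.stableSign_sq]; simp
    have e1 : a (m - j) t - κ * a (m - j - 1) t =
        τ * (stableSign m σ₀ j * lam * κ ^ j) * U t := by
      rw [show m - j - 1 = i by omega]
      simp only [a, hb]
      rw [hi, pow_succ]; ring
    have e2 : ((stableSign m σ₀ j / τ : ℝ) : ℂ) * (a (m - j) t - κ * a (m - j - 1) t) =
        lam * κ ^ j * U t := by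
      rw [e1, Complex.ofReal_div]
      field_simp
      linear_combination lam * κ ^ j * U t * hs
    have e3 : τ * κ ^ j * c * U t + lam * a j t = lam * κ ^ j * U t + τ * r j t := by
      simp only [a, r]; ring
    rw [e3, ← e2]
    simp only [κ]
    ring
  · intro t ht
    exact (le_abs_self _).trans (hR t ht)
  -- The ansatz misses the initial data by `τ b_j v`, with `b 0 = 0`; the weight `τ` in the energy
  -- yields `K τ³`.
  · have e0 : ∀ j < m, p j 0 - a j 0 = -(τ * (b j * v)) := by
      intro j hj
      rw [hpi j hj]
      simp only [a, U, κ]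
      simp
      ring
    have e1 : ∑ j ∈ Finset.Ico 1 m, ‖p j 0 - a j 0‖ ^ 2 = τ ^ 2 * K := by
      simp only [K, Finset.mul_sum]
      refine Finset.sum_congr rfl fun j hj => ?_
      rw [e0 j (Finset.mem_Ico.1 hj).2, norm_neg, norm_mul, Complex.norm_real,
        Real.norm_of_nonneg hτ.le, mul_pow]
    rw [e1, e0 0 hm, hb0]
    simp only [zero_mul, mul_zero, neg_zero, norm_zero]
    nlinarith

/-- Fourier modes of the stable hyperbolization exist for all initial data. -/
theorem exists_mode (m : ℕ) (hm : 1 ≤ m) (σ₀ τ : ℝ) (κ : ℂ) (y₀ : ℕ → ℂ) :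
    ∃ p : ℕ → ℝ → ℂ,
      (∀ t, HasDerivAt (p 0) (-(σ₀ * (κ * p (m - 1) t))) t) ∧
      (∀ j, 1 ≤ j → j < m → ∀ t, HasDerivAt (p j)
        (((stableSign m σ₀ j / τ : ℝ) : ℂ) * (p (m - j) t - κ * p (m - j - 1) t)) t) ∧
      (∀ j < m, p j 0 = y₀ j) := by
  -- Padding by zero lets the rows use natural-number indices; the solution is a matrix exponential
  -- on `Fin m → ℂ`.
  let ext : (Fin m → ℂ) →ₗ[ℂ] (ℕ → ℂ) :=
    LinearMap.pi fun j => if h : j < m then LinearMap.proj ⟨j, h⟩ else 0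
  let ρ : (ℕ → ℂ) →ₗ[ℂ] (Fin m → ℂ) := LinearMap.pi fun i =>
    if (i : ℕ) = 0 then (-(σ₀ * κ)) • LinearMap.proj (m - 1)
    else ((stableSign m σ₀ i / τ : ℝ) : ℂ) •
      (LinearMap.proj (m - i) - κ • LinearMap.proj (m - i - 1))
  let A : (Fin m → ℂ) →L[ℂ] (Fin m → ℂ) := LinearMap.toContinuousLinearMap (ρ ∘ₗ ext)
  let y : ℝ → Fin m → ℂ := fun t => NormedSpace.exp (t • A) (fun i => y₀ i)
  have hy : ∀ t, HasDerivAt y (A (y t)) t := by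
    intro t
    have h := hasDerivAt_exp_smul_const' (𝕂 := ℝ) A t
    have h2 := ((ContinuousLinearMap.apply ℂ (Fin m → ℂ) (fun i : Fin m => y₀ i)).restrictScalars
      ℝ).hasFDerivAt.comp_hasDerivAt t h
    exact h2
  have hext : ∀ z j (h : j < m), ext z j = z ⟨j, h⟩ := by
    intro z j h
    simp [ext, h]
  have hd : ∀ j (h : j < m) t, HasDerivAt (fun t => ext (y t) j) (ρ (ext (y t)) ⟨j, h⟩) t := by
    intro j h t
    simp only [hext _ j h]
    exact hasDerivAt_pi.1 (hy t) ⟨j, h⟩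
  refine ⟨fun j t => ext (y t) j, fun t => ?_, fun j h1 hj t => ?_, fun j hj => ?_⟩
  · refine (hd 0 hm t).congr_deriv ?_
    simp [ρ, mul_assoc]
  · refine (hd j hj t).congr_deriv ?_
    simp [ρ, show j ≠ 0 by omega]
  · have h0 : y 0 = fun i : Fin m => y₀ i := by
      have hA : (0 : ℝ) • A = 0 := zero_smul ℝ A
      simp only [y]
      rw [hA, NormedSpace.exp_zero]
      rfl
    simp only [hext _ j hj, h0]

/-! ### Explicit solutions as trigonometric sums -/

section TrigonometricSums

variable {n : ℕ} (k : Fin n → ℝ)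

/-- The trigonometric sum with amplitudes `a` and wavenumbers `k`. -/
noncomputable def trigSum (a : Fin n → ℂ) (x : ℝ) : ℂ :=
  ∑ j, a j * Complex.exp (Complex.I * k j * x)

theorem hasDerivAt_trigSum (a : Fin n → ℂ) (x : ℝ) :
    HasDerivAt (trigSum k a) (trigSum k (fun j => a j * (Complex.I * k j)) x) x := by
  refine HasDerivAt.fun_sum fun j _ => ?_
  have h1 : HasDerivAt (fun x : ℝ => Complex.I * k j * (x : ℂ)) (Complex.I * k j) x := by
    simpa using (Complex.ofRealCLM.hasDerivAt (x := x)).const_mul (Complex.I * k j)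
  refine (h1.cexp.const_mul (a j)).congr_deriv ?_
  ring

theorem deriv_trigSum (a : Fin n → ℂ) :
    deriv (trigSum k a) = trigSum k (fun j => a j * (Complex.I * k j)) :=
  funext fun x => (hasDerivAt_trigSum k a x).deriv

theorem iteratedDeriv_trigSum (a : Fin n → ℂ) (l : ℕ) :
    iteratedDeriv l (trigSum k a) = trigSum k (fun j => a j * (Complex.I * k j) ^ l) := by
  induction l with
  | zero => simp
  | succ l ih =>
    rw [iteratedDeriv_succ, ih, deriv_trigSum]
    simp only [mul_assoc, pow_succ]

theorem contDiff_trigSum (a : Fin n → ℂ) (l : ℕ) : ContDiff ℝ l (trigSum k a) := by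
  have : ContDiff ℝ l fun x : ℝ => (x : ℂ) := Complex.ofRealCLM.contDiff
  unfold trigSum
  fun_prop

theorem norm_trigSum_le (a : Fin n → ℂ) (x : ℝ) : ‖trigSum k a x‖ ≤ ∑ j, ‖a j‖ := by
  refine norm_sum_le_of_le _ fun j _ => ?_
  rw [norm_mul, show Complex.I * k j * x = ((k j * x : ℝ) : ℂ) * Complex.I by push_cast; ring,
    Complex.norm_exp_ofReal_mul_I, mul_one]

theorem hasDerivAt_trigSum_amplitude {a : Fin n → ℝ → ℂ} {a' : Fin n → ℂ} {t : ℝ}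
    (ha : ∀ j, HasDerivAt (a j) (a' j) t) (x : ℝ) :
    HasDerivAt (fun s => trigSum k (fun j => a j s) x) (trigSum k a' x) t :=
  HasDerivAt.fun_sum fun j _ => (ha j).mul_const _

theorem exists_bound_iteratedDeriv_trigSum {a : Fin n → ℝ → ℂ} (ha : ∀ j, Continuous (a j))
    (L : ℕ) (T : ℝ) : ∃ M : ℝ, ∀ t, 0 ≤ t → t ≤ T → ∀ l ≤ L, ∀ x,
      ‖iteratedDeriv l (trigSum k fun j => a j t) x‖ ≤ M := by
  have hc : Continuous fun t =>
      ∑ l ∈ Finset.range (L + 1), ∑ j, ‖a j t * (Complex.I * k j) ^ l‖ := by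
    fun_prop
  obtain ⟨M, hM⟩ := isCompact_Icc.exists_bound_of_continuousOn (s := Set.Icc 0 T) hc.continuousOn
  refine ⟨M, fun t h0 hT l hl x => ?_⟩
  rw [iteratedDeriv_trigSum]
  refine (norm_trigSum_le k _ x).trans (le_trans ?_ ((le_abs_self _).trans (hM t ⟨h0, hT⟩)))
  exact Finset.single_le_sum
    (f := fun l => ∑ j, ‖a j t * (Complex.I * k j) ^ l‖)
    (fun l _ => Finset.sum_nonneg fun j _ => norm_nonneg _)
    (Finset.mem_range.2 (Nat.lt_succ_of_le hl))

theorem isModelSolution_trigSum (m : ℕ) (σ₀ : ℝ) (c : Fin n → ℂ) :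
    IsModelSolution m σ₀ (trigSum k c) fun x t =>
      trigSum k (fun j => c j * Complex.exp (-(σ₀ * (Complex.I * k j) ^ m) * t)) x where
  contDiff t _ := contDiff_trigSum k _ m
  bounded T := exists_bound_iteratedDeriv_trigSum k
    (a := fun j t => c j * Complex.exp (-(σ₀ * (Complex.I * k j) ^ m) * t))
    (fun j => by fun_prop) m T
  equation x t _ := by
    have h : ∀ j, HasDerivAt
        (fun t : ℝ => c j * Complex.exp (-(σ₀ * (Complex.I * k j) ^ m) * t))
        (c j * (Complex.exp (-(σ₀ * (Complex.I * k j) ^ m) * t) *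
          -(σ₀ * (Complex.I * k j) ^ m))) t := fun j => by
      have h1 : HasDerivAt (fun t : ℝ => -(σ₀ * (Complex.I * k j) ^ m) * (t : ℂ))
          (-(σ₀ * (Complex.I * k j) ^ m)) t := by
        simpa using (Complex.ofRealCLM.hasDerivAt (x := t)).const_mul
          (-(σ₀ * (Complex.I * k j) ^ m))
      exact h1.cexp.const_mul (c j)
    refine ((hasDerivAt_trigSum_amplitude k h x).congr_deriv ?_).hasDerivWithinAt
    change _ = -(σ₀ * iteratedDeriv m (trigSum k _) x)
    rw [iteratedDeriv_trigSum]
    simp only [trigSum, Finset.mul_sum, ← Finset.sum_neg_distrib]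
    exact Finset.sum_congr rfl fun j _ => by ring
  initial x := by simp

theorem isHyperbolizationSolution_trigSum {m : ℕ} {σ₀ τ : ℝ} (c : Fin n → ℂ)
    {p : Fin n → ℕ → ℝ → ℂ}
    (hp0 : ∀ i t, HasDerivAt (p i 0) (-(σ₀ * (Complex.I * k i * p i (m - 1) t))) t)
    (hp : ∀ i j, 1 ≤ j → j < m → ∀ t, HasDerivAt (p i j) (((stableSign m σ₀ j / τ : ℝ) : ℂ) *
      (p i (m - j) t - Complex.I * k i * p i (m - j - 1) t)) t)
    (hpi : ∀ i, ∀ j < m, p i j 0 = c i * (Complex.I * k i) ^ j) :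
    IsHyperbolizationSolution m σ₀ τ (trigSum k c) fun j x t =>
      trigSum k (fun i => p i j t) x where
  contDiff j _ t _ := contDiff_trigSum k _ 1
  bounded T := by
    have hc : ∀ j < m, ∀ i, Continuous (p i j) := by
      intro j hj i
      rcases Nat.eq_zero_or_pos j with rfl | h1
      · exact continuous_iff_continuousAt.2 fun t => (hp0 i t).continuousAt
      · exact continuous_iff_continuousAt.2 fun t => (hp i j h1 hj t).continuousAt
    have h : ∀ j : Fin m, ∃ M : ℝ, ∀ t, 0 ≤ t → t ≤ T → ∀ l ≤ 1, ∀ x,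
        ‖iteratedDeriv l (trigSum k fun i => p i j t) x‖ ≤ M := fun j =>
      exists_bound_iteratedDeriv_trigSum k (a := fun i => p i j) (hc j j.2) 1 T
    choose M hM using h
    have hle : ∀ j : Fin m, M j ≤ ∑ j, |M j| := fun j => (le_abs_self _).trans
      (Finset.single_le_sum (f := fun j => |M j|) (fun j _ => abs_nonneg _) (Finset.mem_univ j))
    refine ⟨∑ j, |M j|, fun t h0 hT j hj x => ⟨?_, ?_⟩⟩
    · simpa using (hM ⟨j, hj⟩ t h0 hT 0 (by norm_num) x).trans (hle ⟨j, hj⟩)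
    · have := (hM ⟨j, hj⟩ t h0 hT 1 le_rfl x).trans (hle ⟨j, hj⟩)
      rwa [iteratedDeriv_one] at this
  equation_zero x t _ := by
    refine ((hasDerivAt_trigSum_amplitude k (fun i => hp0 i t) x).congr_deriv ?_).hasDerivWithinAt
    change _ = -(σ₀ * deriv (trigSum k _) x)
    rw [deriv_trigSum]
    simp only [trigSum, Finset.mul_sum, ← Finset.sum_neg_distrib]
    exact Finset.sum_congr rfl fun j _ => by ring
  equation_succ j h1 hj x t _ := by
    refine ((hasDerivAt_trigSum_amplitude k (fun i => hp i j h1 hj t)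
      x).congr_deriv ?_).hasDerivWithinAt
    change _ = _ * (trigSum k _ x - deriv (trigSum k _) x)
    rw [deriv_trigSum]
    simp only [trigSum, ← Finset.sum_sub_distrib, Finset.mul_sum]
    exact Finset.sum_congr rfl fun j _ => by ring
  initial j hj x := by
    rw [iteratedDeriv_trigSum]
    simp only [hpi _ j hj]

end TrigonometricSums

/-! ### Uniqueness for the two Cauchy problems -/

section SolutionUniqueness

variable {m : ℕ} {σ₀ : ℝ} {u₀ : ℝ → ℂ}

theorem IsModelSolution.unique {u u' : ℝ → ℝ → ℂ} (hu : IsModelSolution m σ₀ u₀ u)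
    (hu' : IsModelSolution m σ₀ u₀ u') (x : ℝ) {t : ℝ} (ht : 0 ≤ t) : u x t = u' x t := by
  have hsub : ∀ t, 0 ≤ t → ∀ l ≤ m, ∀ x, iteratedDeriv l (fun y => u y t - u' y t) x =
      iteratedDeriv l (fun y => u y t) x - iteratedDeriv l (fun y => u' y t) x := by
    intro t ht l hl x
    exact iteratedDeriv_fun_sub
      ((hu.contDiff t ht).of_le (by exact_mod_cast hl)).contDiffAt
      ((hu'.contDiff t ht).of_le (by exact_mod_cast hl)).contDiffAt
  refine sub_eq_zero.1 (eq_zero_of_hasDerivWithinAt (ι := Unit) (L := m)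
    (A := fun _ _ l => if l = m then -(σ₀ : ℂ) else 0) (w := fun _ x t => u x t - u' x t)
    (fun _ t ht => (hu.contDiff t ht).sub (hu'.contDiff t ht)) (fun T => ?_)
    (fun _ x t ht => ?_) (fun _ x => ?_) () x ht)
  · obtain ⟨M, hM⟩ := hu.bounded T
    obtain ⟨M', hM'⟩ := hu'.bounded T
    refine ⟨M + M', fun _ t ht hT l hl x => ?_⟩
    rw [hsub t ht l hl x]
    exact (norm_sub_le _ _).trans (add_le_add (hM t ht hT l hl x) (hM' t ht hT l hl x))
  · refine ((hu.equation x t ht).sub (hu'.equation x t ht)).congr_deriv ?_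
    simp only [Finset.univ_unique, Finset.sum_singleton, ite_mul, zero_mul]
    rw [Finset.sum_ite_eq' (Finset.range (m + 1)) m, if_pos (by simp), hsub t ht m le_rfl x]
    ring
  · rw [hu.initial, hu'.initial, sub_self]

theorem IsHyperbolizationSolution.unique (hm : 1 ≤ m) {τ : ℝ} {q q' : ℕ → ℝ → ℝ → ℂ}
    (hq : IsHyperbolizationSolution m σ₀ τ u₀ q)
    (hq' : IsHyperbolizationSolution m σ₀ τ u₀ q') {j : ℕ} (hj : j < m) (x : ℝ) {t : ℝ}
    (ht : 0 ≤ t) : q j x t = q' j x t := by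
  have hdiff : ∀ j < m, ∀ t, 0 ≤ t → ∀ x, deriv (fun y => q j y t - q' j y t) x =
      deriv (fun y => q j y t) x - deriv (fun y => q' j y t) x := by
    intro j hj t ht x
    exact deriv_fun_sub ((hq.contDiff j hj t ht).differentiable (by norm_num) x)
      ((hq'.contDiff j hj t ht).differentiable (by norm_num) x)
  have hsum : ∀ (c : ℕ) (hc : c < m) (f : Fin m → ℂ) (a : ℂ),
      ∑ j : Fin m, (if (j : ℕ) = c then a else 0) * f j = a * f ⟨c, hc⟩ := by
    intro c hc f a
    rw [Finset.sum_eq_single ⟨c, hc⟩]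
    · simp
    · intro b _ hb
      rw [if_neg fun h => hb (Fin.ext h), zero_mul]
    · simp
  refine sub_eq_zero.1 (eq_zero_of_hasDerivWithinAt (ι := Fin m) (L := 1)
    -- Each row has one entry of order `l = 1`, in column `m - i - 1` (`m - 1` for row `0`), and
    -- each row `i ≥ 1` one of order `0`, in column `m - i`.
    (A := fun i j l =>
      if (i : ℕ) = 0 then
        if l = 0 then 0 else if (j : ℕ) = m - 1 then -(σ₀ : ℂ) else 0
      else
        if l = 0 then if (j : ℕ) = m - i then ((stableSign m σ₀ i / τ : ℝ) : ℂ) else 0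
        else if (j : ℕ) = m - i - 1 then -((stableSign m σ₀ i / τ : ℝ) : ℂ) else 0)
    (w := fun i x t => q i x t - q' i x t)
    (fun i t ht => (hq.contDiff i i.2 t ht).sub (hq'.contDiff i i.2 t ht)) (fun T => ?_)
    (fun i x t ht => ?_) (fun i x => ?_) ⟨j, hj⟩ x ht)
  · obtain ⟨M, hM⟩ := hq.bounded T
    obtain ⟨M', hM'⟩ := hq'.bounded T
    refine ⟨M + M', fun i t ht hT l hl x => ?_⟩
    have h1 := hM t ht hT i i.2 x
    have h2 := hM' t ht hT i i.2 x
    interval_cases l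
    · simpa using (norm_sub_le _ _).trans (add_le_add h1.1 h2.1)
    · rw [iteratedDeriv_one, hdiff i i.2 t ht x]
      exact (norm_sub_le _ _).trans (add_le_add h1.2 h2.2)
  · have hi := i.2
    simp only [Finset.sum_range_succ, Finset.sum_range_zero, zero_add, iteratedDeriv_zero,
      iteratedDeriv_one, Finset.sum_add_distrib, if_true, one_ne_zero, if_false]
    by_cases h : (i : ℕ) = 0
    · simp only [h, if_true, zero_mul, Finset.sum_const_zero, zero_add]
      rw [hsum (m - 1) (by omega), hdiff (m - 1) (by omega) t ht x]
      refine ((hq.equation_zero x t ht).sub (hq'.equation_zero x t ht)).congr_deriv ?_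
      ring
    · simp only [h, if_false]
      rw [hsum (m - i) (by omega) (fun j => q j x t - q' j x t),
        hsum (m - i - 1) (by omega), hdiff (m - i - 1) (by omega) t ht x]
      refine ((hq.equation_succ i (by omega) hi x t ht).sub
        (hq'.equation_succ i (by omega) hi x t ht)).congr_deriv ?_
      ring
  · rw [hq.initial i i.2, hq'.initial i i.2, sub_self]

end SolutionUniqueness

end Hyperbolization

/-! ### Superposition of the modes -/

theorem mainTheorem3 (m : ℕ) (hm : 1 ≤ m) (σ₀ : ℝ)
    (hσ : Hyperbolization.AdmissibleSign m σ₀)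
    (n : ℕ) (u₀ : ℝ → ℂ) (hu₀ : u₀ ∈ Hyperbolization.FourierSpace n) :
    (∃ u : ℝ → ℝ → ℂ, Hyperbolization.IsModelSolution m σ₀ u₀ u) ∧
    (∀ τ : ℝ, 0 < τ →
      ∃ q : ℕ → ℝ → ℝ → ℂ, Hyperbolization.IsHyperbolizationSolution m σ₀ τ u₀ q) ∧
    ∀ u : ℝ → ℝ → ℂ, Hyperbolization.IsModelSolution m σ₀ u₀ u →
      ∀ q : ℝ → ℕ → ℝ → ℝ → ℂ,
        (∀ τ : ℝ, 0 < τ → Hyperbolization.IsHyperbolizationSolution m σ₀ τ u₀ (q τ)) →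
        ∀ T : ℝ, 0 ≤ T →
          ∃ C : ℝ, ∀ᶠ τ in 𝓝[>] (0 : ℝ), ∀ x : ℝ, ‖q τ 0 x T - u x T‖ ≤ C * τ := by
  obtain ⟨c, k, hck⟩ := hu₀
  obtain rfl : u₀ = Hyperbolization.trigSum k c := funext hck
  have hu' := Hyperbolization.isModelSolution_trigSum k m σ₀ c
  have hmode := fun (τ : ℝ) (i : Fin n) => Hyperbolization.exists_mode m hm σ₀ τ
    (Complex.I * k i) (fun j => c i * (Complex.I * k i) ^ j)
  choose p hp0 hp hpi using hmode
  have hq' := fun τ => Hyperbolization.isHyperbolizationSolution_trigSum k (τ := τ) c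
    (hp0 τ) (hp τ) (hpi τ)
  refine ⟨⟨_, hu'⟩, fun τ _ => ⟨_, hq' τ⟩, fun u hu q hq T hT => ?_⟩
  choose C hC using fun i : Fin n => hσ.mode_error hm (k i) (c i) hT
  refine ⟨∑ i, C i, ?_⟩
  filter_upwards [Ioc_mem_nhdsGT (zero_lt_one' ℝ)] with τ hτ x
  -- By uniqueness the given solutions are the explicit sums, so the error is a trigonometric sum
  -- bounded by its mode errors uniformly in `x`.
  rw [(hq τ hτ.1).unique hm (hq' τ) hm x hT, hu.unique hu' x hT, Finset.sum_mul]
  have hsub : Hyperbolization.trigSum k (fun i => p τ i 0 T) x - Hyperbolization.trigSum k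
      (fun i => c i * Complex.exp (-(σ₀ * (Complex.I * k i) ^ m) * T)) x =
      Hyperbolization.trigSum k (fun i => p τ i 0 T -
        c i * Complex.exp (-(σ₀ * (Complex.I * k i) ^ m) * T)) x := by
    simp only [Hyperbolization.trigSum, sub_mul, Finset.sum_sub_distrib]
  rw [hsub]
  exact (Hyperbolization.norm_trigSum_le k _ x).trans (Finset.sum_le_sum fun i _ =>
    hC i τ hτ.1 hτ.2 (p τ i) (hp0 τ i) (hp τ i) (hpi τ i))
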